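/- Fix an integer $n\ge 0$ and any monomial order $\succ$ on the polynomial ring $\mathbb{C}[s,u,v]$ with $u\succ v$. For a subalgebra $S\subseteq\mathbb{C}[s,u,v]$, its initial algebra is the linear span $S_{\mathrm{in}}=\operatorname{span}_{\mathbb{C}}\{\mathrm{LT}(f)\mid f\in S\}$ of the leading terms with respect to $\succ$ of all elements of $S$, and a subset $G\subseteq S$ is called a Khovanskii basis of $S$ if the leading monomials of the elements of $G$ generate $S_{\mathrm{in}}$ as a $\mathbb{C}$-algebra. Then the polynomials $$s,\qquad su(u^2+v^2)^{k-1},\qquad sv(u^2+v^2)^{k-1}\qquad (1\le k\le n)$$ form a Khovanskii basis of the subalgebra of $\mathbb{C}[s,u,v]$ that they generate. -/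

import Mathlib

open MvPolynomial
open scoped MonomialOrder

noncomputable section

/-- The leading monomial (with coefficient `1`) of a polynomial with respect to a monomial order. -/
def leadingMonomial {σ K : Type*} [Field K] (m : MonomialOrder σ) (f : MvPolynomial σ K) :
    MvPolynomial σ K :=
  monomial (m.degree f) 1

/-- The initial algebra of a subalgebra `S` of a polynomial ring over a field: the linear span of
the leading terms of all elements of `S`, which is closed under multiplication. -/
def initialAlgebra {σ K : Type*} [Field K] (m : MonomialOrder σ)
    (S : Subalgebra K (MvPolynomial σ K)) : Subalgebra K (MvPolynomial σ K) :=
  (Submodule.span K {t | ∃ f ∈ S, t = m.leadingTerm f}).toSubalgebra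
    (Submodule.subset_span ⟨1, S.one_mem, by simp [MonomialOrder.leadingTerm]⟩)
    (by
      intro x y hx hy
      have hxy := Submodule.mul_mem_mul hx hy
      rw [Submodule.span_mul_span] at hxy
      refine Submodule.span_mono ?_ hxy
      rintro _ ⟨_, ⟨f, hf, rfl⟩, _, ⟨g, hg, rfl⟩, rfl⟩
      refine ⟨f * g, S.mul_mem hf hg, ?_⟩
      by_cases hf0 : f = 0
      · simp [hf0, MonomialOrder.leadingTerm]
      by_cases hg0 : g = 0
      · simp [hg0, MonomialOrder.leadingTerm]
      simp [MonomialOrder.leadingTerm, MonomialOrder.degree_mul hf0 hg0,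
        MonomialOrder.leadingCoeff_mul, monomial_mul])

/-- A set `G` of polynomials is a Khovanskii basis (also: SAGBI basis) of the subalgebra `S`, with
respect to the monomial order `m`, if `G` is contained in `S` and the leading monomials of the
elements of `G` generate the initial algebra of `S`. -/
def IsKhovanskiiBasis {σ K : Type*} [Field K] (m : MonomialOrder σ)
    (S : Subalgebra K (MvPolynomial σ K)) (G : Set (MvPolynomial σ K)) : Prop :=
  G ⊆ (S : Set (MvPolynomial σ K)) ∧
    Algebra.adjoin K (leadingMonomial m '' G) = initialAlgebra m S

/-- The variable `s` of `ℂ[s, u, v]`. -/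
abbrev varS : MvPolynomial (Fin 3) ℂ := X 0

/-- The variable `u` of `ℂ[s, u, v]`. -/
abbrev varU : MvPolynomial (Fin 3) ℂ := X 1

/-- The variable `v` of `ℂ[s, u, v]`. -/
abbrev varV : MvPolynomial (Fin 3) ℂ := X 2

/-- The polynomials `s`, `s u (u² + v²)^(k-1)` and `s v (u² + v²)^(k-1)` for `1 ≤ k ≤ n`. -/
def resonatorGenerators (n : ℕ) : Set (MvPolynomial (Fin 3) ℂ) :=
  {varS} ∪
    {f | ∃ k : ℕ, 1 ≤ k ∧ k ≤ n ∧ f = varS * varU * (varU ^ 2 + varV ^ 2) ^ (k - 1)} ∪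
    {f | ∃ k : ℕ, 1 ≤ k ∧ k ≤ n ∧ f = varS * varV * (varU ^ 2 + varV ^ 2) ^ (k - 1)}

end

/-! The generators are homogeneous for the bigrading by s-degree and (u, v)-degree, so the
subalgebra is bigraded. A product with c generators other than s is (u² + v²)^e h, where h has (u,
v)-degree c and e ≤ c(n - 1). In a fixed bidegree c + 2e is constant, so this shape survives sums
(`resonatorComponent`). As u ≻ v, its leading monomial is s^d u^(a+2e) v^b with a + b = c ≤ d, and
this factors into the leading monomials s, s u^(2k-1), s v u^(2k-2)
(`X_pow_mem_adjoin_leadingMonomial`). -/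

/-- A leading monomial of an element of `S` lies in the initial algebra of `S`. -/
theorem leadingMonomial_mem_initialAlgebra {σ K : Type*} [Field K] (m : MonomialOrder σ)
    (S : Subalgebra K (MvPolynomial σ K)) {f : MvPolynomial σ K} (hf : f ∈ S) :
    leadingMonomial m f ∈ initialAlgebra m S := by
  by_cases h0 : f = 0
  · subst h0
    have h : leadingMonomial m (0 : MvPolynomial σ K) = 1 := by
      simp [leadingMonomial]
    rw [h]
    exact one_mem _
  · have h : leadingMonomial m f = (m.leadingCoeff f)⁻¹ • m.leadingTerm f := by
      have hc : m.leadingCoeff f ≠ 0 := m.leadingCoeff_ne_zero_iff.mpr h0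
      simp [leadingMonomial, MonomialOrder.leadingTerm, smul_monomial, hc]
    rw [h]
    have ht : m.leadingTerm f ∈ initialAlgebra m S := Submodule.subset_span ⟨f, hf, rfl⟩
    exact Subalgebra.smul_mem _ ht _

/-- A subset `G` of `S` is a Khovanskii basis as soon as the leading monomial of each nonzero
element of `S` is generated by those of `G`. -/
theorem isKhovanskiiBasis_of_leadingMonomial_mem {σ K : Type*} [Field K] (m : MonomialOrder σ)
    (S : Subalgebra K (MvPolynomial σ K)) (G : Set (MvPolynomial σ K))
    (hG : G ⊆ (S : Set (MvPolynomial σ K)))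
    (h : ∀ f ∈ S, f ≠ 0 → leadingMonomial m f ∈ Algebra.adjoin K (leadingMonomial m '' G)) :
    IsKhovanskiiBasis m S G := by
  refine ⟨hG, le_antisymm (Algebra.adjoin_le ?_) ?_⟩
  · rintro _ ⟨g, hg, rfl⟩
    exact leadingMonomial_mem_initialAlgebra m S (hG hg)
  · intro t ht
    change t ∈ Submodule.span K {t | ∃ f ∈ S, t = m.leadingTerm f} at ht
    have hle : Submodule.span K {t | ∃ f ∈ S, t = m.leadingTerm f} ≤
        Subalgebra.toSubmodule (Algebra.adjoin K (leadingMonomial m '' G)) := by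
      rw [Submodule.span_le]
      rintro _ ⟨f, hf, rfl⟩
      by_cases h0 : f = 0
      · subst h0
        rw [MonomialOrder.leadingTerm_zero]
        exact zero_mem _
      · have e : m.leadingTerm f = m.leadingCoeff f • leadingMonomial m f := by
          simp [leadingMonomial, MonomialOrder.leadingTerm, smul_monomial]
        rw [e]
        exact Submodule.smul_mem _ _ (h f hf h0)
    exact hle ht

/-- The bigrading of `ℂ[s, u, v]` by the degree in `s` and the total degree in `u, v`. -/
def bigradingWeight : Fin 3 → ℕ × ℕ := ![(1, 0), (0, 1), (0, 1)]

theorem weight_bigradingWeight (D : Fin 3 →₀ ℕ) :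
    Finsupp.weight bigradingWeight D = (D 0, D 1 + D 2) := by
  rw [Finsupp.weight_apply, Finsupp.sum_fintype _ _ (by simp), Fin.sum_univ_three]
  simp [bigradingWeight]

/-- The polynomial `u² + v²`. -/
noncomputable def sumSq : MvPolynomial (Fin 3) ℂ := varU ^ 2 + varV ^ 2

theorem degree_varV_sq_lt (m : MonomialOrder (Fin 3))
    (huv : Finsupp.single (2 : Fin 3) 1 ≺[m] Finsupp.single (1 : Fin 3) 1) :
    m.degree (varV ^ 2) ≺[m] m.degree (varU ^ 2) := by
  rw [m.degree_pow, m.degree_pow, m.degree_X, m.degree_X, two_smul, two_smul, map_add, map_add]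
  exact add_lt_add huv huv

theorem degree_sumSq (m : MonomialOrder (Fin 3))
    (huv : Finsupp.single (2 : Fin 3) 1 ≺[m] Finsupp.single (1 : Fin 3) 1) :
    m.degree sumSq = 2 • Finsupp.single (1 : Fin 3) 1 := by
  rw [sumSq, m.degree_add_of_lt (degree_varV_sq_lt m huv), m.degree_pow, m.degree_X]

theorem sumSq_ne_zero : sumSq ≠ 0 := by
  intro h
  have := congrArg (eval (fun _ : Fin 3 => (1 : ℂ))) h
  norm_num [sumSq] at this

theorem isWeightedHomogeneous_sumSq :
    IsWeightedHomogeneous bigradingWeight sumSq (0, 2) := by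
  have hu : IsWeightedHomogeneous bigradingWeight varU (0, 1) :=
    isWeightedHomogeneous_X ℂ bigradingWeight 1
  have hv : IsWeightedHomogeneous bigradingWeight varV (0, 1) :=
    isWeightedHomogeneous_X ℂ bigradingWeight 2
  exact (hu.pow 2).add (hv.pow 2)

/-- The polynomials of bidegree `(d, N)` of the form `(u² + v²)^e h` with `h` of bidegree `(d, c)`,
where `c ≤ d` and `c + e ≤ c n`. -/
noncomputable def resonatorComponent (n : ℕ) (δ : ℕ × ℕ) : Submodule ℂ (MvPolynomial (Fin 3) ℂ) where
  carrier := {f | f = 0 ∨ ∃ c e h, IsWeightedHomogeneous bigradingWeight h (δ.1, c) ∧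
    c + 2 * e = δ.2 ∧ c ≤ δ.1 ∧ c + e ≤ c * n ∧ f = sumSq ^ e * h}
  zero_mem' := Or.inl rfl
  add_mem' := by
    -- The smaller power of u² + v² divides both summands; the sum inherits the c' and e' of that
    -- summand, hence its inequalities.
    have key : ∀ c e h c' e' h', IsWeightedHomogeneous bigradingWeight h (δ.1, c) →
        c + 2 * e = δ.2 → IsWeightedHomogeneous bigradingWeight h' (δ.1, c') →
        c' + 2 * e' = δ.2 → e' ≤ e → ∃ k, IsWeightedHomogeneous bigradingWeight k (δ.1, c') ∧
          sumSq ^ e * h + sumSq ^ e' * h' = sumSq ^ e' * k := by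
      intro c e h c' e' h' hh h1 hh' h1' hle
      obtain ⟨t, rfl⟩ := Nat.exists_eq_add_of_le hle
      refine ⟨sumSq ^ t * h + h', ?_, by ring⟩
      refine IsWeightedHomogeneous.add ?_ hh'
      have := (isWeightedHomogeneous_sumSq.pow t).mul hh
      convert this using 1
      ext <;> simp
      omega
    rintro f g (rfl | ⟨c, e, h, hh, h1, h2, h3, rfl⟩) hg
    · rwa [zero_add]
    obtain rfl | ⟨c', e', h', hh', h1', h2', h3', rfl⟩ := hg
    · rw [add_zero]
      exact Or.inr ⟨c, e, h, hh, h1, h2, h3, rfl⟩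
    · right
      rcases le_total e' e with hle | hle
      · obtain ⟨k, hk, he⟩ := key c e h c' e' h' hh h1 hh' h1' hle
        exact ⟨c', e', k, hk, h1', h2', h3', he⟩
      · obtain ⟨k, hk, he⟩ := key c' e' h' c e h hh' h1' hh h1 hle
        exact ⟨c, e, k, hk, h1, h2, h3, by rw [add_comm, he]⟩
  smul_mem' := by
    rintro r f (rfl | ⟨c, e, h, hh, h1, h2, h3, rfl⟩)
    · left; simp
    · right
      refine ⟨c, e, C r * h, hh.C_mul r, h1, h2, h3, ?_⟩
      rw [smul_eq_C_mul]; ring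

theorem isWeightedHomogeneous_of_mem_resonatorComponent {n : ℕ} {δ : ℕ × ℕ}
    {f : MvPolynomial (Fin 3) ℂ} (hf : f ∈ resonatorComponent n δ) :
    IsWeightedHomogeneous bigradingWeight f δ := by
  obtain rfl | ⟨c, e, h, hh, h1, -, -, rfl⟩ := hf
  · exact isWeightedHomogeneous_zero ℂ _ _
  · convert (isWeightedHomogeneous_sumSq.pow e).mul hh using 1
    ext <;> simp
    omega

theorem mul_mem_resonatorComponent {n : ℕ} {δ δ' : ℕ × ℕ} {f g : MvPolynomial (Fin 3) ℂ}
    (hf : f ∈ resonatorComponent n δ) (hg : g ∈ resonatorComponent n δ') :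
    f * g ∈ resonatorComponent n (δ + δ') := by
  obtain rfl | ⟨c, e, h, hh, h1, h2, h3, rfl⟩ := hf
  · rw [zero_mul]; exact zero_mem _
  obtain rfl | ⟨c', e', h', hh', h1', h2', h3', rfl⟩ := hg
  · rw [mul_zero]; exact zero_mem _
  refine Or.inr ⟨c + c', e + e', h * h', hh.mul hh', ?_, ?_, ?_, by ring⟩
  · simp only [Prod.snd_add]; omega
  · simp only [Prod.fst_add]; omega
  · rw [add_mul]; omega

theorem exists_mem_resonatorComponent_of_mem_closure {n : ℕ} {f : MvPolynomial (Fin 3) ℂ}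
    (hf : f ∈ Submonoid.closure (resonatorGenerators n)) :
    ∃ δ, f ∈ resonatorComponent n δ := by
  have hs : IsWeightedHomogeneous bigradingWeight varS (1, 0) :=
    isWeightedHomogeneous_X ℂ bigradingWeight 0
  have hu : IsWeightedHomogeneous bigradingWeight varU (0, 1) :=
    isWeightedHomogeneous_X ℂ bigradingWeight 1
  have hv : IsWeightedHomogeneous bigradingWeight varV (0, 1) :=
    isWeightedHomogeneous_X ℂ bigradingWeight 2
  induction hf using Submonoid.closure_induction with
  | mem x hx =>
    obtain (rfl | ⟨k, hk, hkn, rfl⟩) | ⟨k, hk, hkn, rfl⟩ := hx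
    · exact ⟨(1, 0), Or.inr ⟨0, 0, varS, hs, by simp, by simp, by simp, by simp⟩⟩
    · exact ⟨(1, 1 + 2 * (k - 1)), Or.inr ⟨1, k - 1, varS * varU, hs.mul hu, rfl, le_rfl,
        by omega, by rw [sumSq]; ring⟩⟩
    · exact ⟨(1, 1 + 2 * (k - 1)), Or.inr ⟨1, k - 1, varS * varV, hs.mul hv, rfl, le_rfl,
        by omega, by rw [sumSq]; ring⟩⟩
  | one =>
    exact ⟨0, Or.inr ⟨0, 0, 1, isWeightedHomogeneous_one ℂ _, by simp, by simp, by simp, by simp⟩⟩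
  | mul x y _ _ hx hy =>
    obtain ⟨δ, hδ⟩ := hx
    obtain ⟨δ', hδ'⟩ := hy
    exact ⟨_, mul_mem_resonatorComponent hδ hδ'⟩

/-- Products of generators span the subalgebra, and the projection fixes or kills each of them. -/
theorem weightedHomogeneousComponent_mem_resonatorComponent {n : ℕ} {f : MvPolynomial (Fin 3) ℂ}
    (hf : f ∈ Algebra.adjoin ℂ (resonatorGenerators n)) (δ : ℕ × ℕ) :
    weightedHomogeneousComponent bigradingWeight δ f ∈ resonatorComponent n δ := by
  have hle : Subalgebra.toSubmodule (Algebra.adjoin ℂ (resonatorGenerators n)) ≤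
      (resonatorComponent n δ).comap (weightedHomogeneousComponent bigradingWeight δ) := by
    rw [Algebra.adjoin_eq_span, Submodule.span_le]
    intro x hx
    obtain ⟨δ', hδ'⟩ := exists_mem_resonatorComponent_of_mem_closure hx
    have hw := isWeightedHomogeneous_of_mem_resonatorComponent hδ'
    change weightedHomogeneousComponent bigradingWeight δ x ∈ resonatorComponent n δ
    rw [weightedHomogeneousComponent_of_mem ((mem_weightedHomogeneousSubmodule ℂ _ _ _).mpr hw)]
    split_ifs with h
    · rwa [h]
    · exact zero_mem _
  exact hle hf

theorem monomial_eq_X_pow (D : Fin 3 →₀ ℕ) :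
    monomial D (1 : ℂ) = X 0 ^ D 0 * X 1 ^ D 1 * X 2 ^ D 2 := by
  rw [monomial_eq, Finsupp.prod_fintype _ _ (by simp), Fin.prod_univ_three]
  simp

theorem leadingMonomial_mul {σ K : Type*} [Field K] (m : MonomialOrder σ) {f g : MvPolynomial σ K}
    (hf : f ≠ 0) (hg : g ≠ 0) :
    leadingMonomial m (f * g) = leadingMonomial m f * leadingMonomial m g := by
  rw [leadingMonomial, m.degree_mul hf hg]
  simp [leadingMonomial, monomial_mul]

theorem leadingMonomial_X {σ K : Type*} [Field K] (m : MonomialOrder σ) (i : σ) :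
    leadingMonomial m (X i : MvPolynomial σ K) = X i := by
  rw [leadingMonomial, m.degree_X, X]

theorem leadingMonomial_sumSq_pow (m : MonomialOrder (Fin 3))
    (huv : Finsupp.single (2 : Fin 3) 1 ≺[m] Finsupp.single (1 : Fin 3) 1) (e : ℕ) :
    leadingMonomial m (sumSq ^ e) = X 1 ^ (2 * e) := by
  rw [leadingMonomial, m.degree_pow, degree_sumSq m huv, X_pow_eq_monomial]
  congr 1
  ext i
  simp [mul_comm]

/-- Induction on c splits off one factor s u^(1+2e₀) or s v u^(2e₀) at a time; the d - c leftover
factors are copies of s. -/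
theorem X_pow_mem_adjoin_leadingMonomial (n : ℕ) (m : MonomialOrder (Fin 3))
    (huv : Finsupp.single (2 : Fin 3) 1 ≺[m] Finsupp.single (1 : Fin 3) 1) (c : ℕ) :
    ∀ a b d e : ℕ, a + b = c → c ≤ d → c + e ≤ c * n →
      (X 0 ^ d * X 1 ^ (a + 2 * e) * X 2 ^ b : MvPolynomial (Fin 3) ℂ) ∈
        Algebra.adjoin ℂ (leadingMonomial m '' resonatorGenerators n) := by
  have hs : (X 0 : MvPolynomial (Fin 3) ℂ) ∈
      Algebra.adjoin ℂ (leadingMonomial m '' resonatorGenerators n) :=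
    Algebra.subset_adjoin ⟨varS, Or.inl (Or.inl rfl), leadingMonomial_X m 0⟩
  have lm (i : Fin 3) (e : ℕ) : leadingMonomial m (varS * X i * (varU ^ 2 + varV ^ 2) ^ e) =
      X 0 * X i * X 1 ^ (2 * e) := by
    rw [← sumSq, leadingMonomial_mul m (mul_ne_zero (X_ne_zero _) (X_ne_zero _))
      (pow_ne_zero _ sumSq_ne_zero), leadingMonomial_mul m (X_ne_zero _) (X_ne_zero _),
      leadingMonomial_X, leadingMonomial_X, leadingMonomial_sumSq_pow m huv]
  have hu (e : ℕ) (he : e + 1 ≤ n) : (X 0 * X 1 * X 1 ^ (2 * e) : MvPolynomial (Fin 3) ℂ) ∈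
      Algebra.adjoin ℂ (leadingMonomial m '' resonatorGenerators n) :=
    Algebra.subset_adjoin ⟨_, Or.inl (Or.inr ⟨e + 1, by omega, he, rfl⟩), lm 1 e⟩
  have hv (e : ℕ) (he : e + 1 ≤ n) : (X 0 * X 2 * X 1 ^ (2 * e) : MvPolynomial (Fin 3) ℂ) ∈
      Algebra.adjoin ℂ (leadingMonomial m '' resonatorGenerators n) :=
    Algebra.subset_adjoin ⟨_, Or.inr ⟨e + 1, by omega, he, rfl⟩, lm 2 e⟩
  induction c with
  | zero =>
    intro a b d e hab _ he
    obtain ⟨rfl, rfl, rfl⟩ : a = 0 ∧ b = 0 ∧ e = 0 := by omega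
    simpa using pow_mem hs d
  | succ c ih =>
    intro a b d e hab hd he
    obtain ⟨d, rfl⟩ : ∃ d', d = d' + 1 := ⟨d - 1, by omega⟩
    have hn : 1 ≤ n := by
      by_contra h0
      obtain rfl : n = 0 := by omega
      simp at he
    have hcn : c ≤ c * n := Nat.le_mul_of_pos_right c hn
    rw [add_mul, one_mul] at he
    -- Greedy choice e₀ = min(e, n - 1): the remainder then fits into the other c factors.
    obtain ⟨e₀, e₁, rfl, h₀, h₁⟩ : ∃ e₀ e₁, e = e₀ + e₁ ∧ e₀ + 1 ≤ n ∧ c + e₁ ≤ c * n := by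
      rcases le_total (e + 1) n with h | h
      · exact ⟨e, 0, rfl, h, hcn⟩
      · exact ⟨n - 1, e - (n - 1), by omega, by omega, by omega⟩
    rcases a with _ | a
    · obtain ⟨b, rfl⟩ : ∃ b', b = b' + 1 := ⟨b - 1, by omega⟩
      convert mul_mem (hv e₀ h₀) (ih 0 b d e₁ (by omega) (by omega) h₁) using 1
      ring
    · convert mul_mem (hu e₀ h₀) (ih a b d e₁ (by omega) (by omega) h₁) using 1
      ring

theorem mainTheorem10 (n : ℕ) (m : MonomialOrder (Fin 3))
    (huv : Finsupp.single (2 : Fin 3) 1 ≺[m] Finsupp.single (1 : Fin 3) 1) :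
    IsKhovanskiiBasis m (Algebra.adjoin ℂ (resonatorGenerators n)) (resonatorGenerators n) := by
  refine isKhovanskiiBasis_of_leadingMonomial_mem m _ _ Algebra.subset_adjoin ?_
  intro f hf hf0
  -- The bihomogeneous component of f containing its leading monomial has the same leading monomial,
  -- so g can replace f.
  set δ := Finsupp.weight bigradingWeight (m.degree f) with hδ
  set g := weightedHomogeneousComponent bigradingWeight δ f with hg
  have hmem : g ∈ resonatorComponent n δ :=
    weightedHomogeneousComponent_mem_resonatorComponent hf δ
  have hsupp : m.degree f ∈ g.support := by
    rw [hg, support_weightedHomogeneousComponent, Finset.mem_filter]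
    exact ⟨m.degree_mem_support hf0, rfl⟩
  have hdeg : m.degree g = m.degree f := by
    apply m.toSyn.injective
    refine le_antisymm (m.degree_le_degree_of_support_subset ?_) (m.le_degree hsupp)
    rw [hg, support_weightedHomogeneousComponent]
    exact Finset.filter_subset _ _
  have hg0 : g ≠ 0 := by
    intro h
    simp [h] at hsupp
  obtain h0 | ⟨c, e, h, hh, -, h2, h3, hgh⟩ := hmem
  · exact absurd h0 hg0
  have hh0 : h ≠ 0 := by
    rintro rfl
    exact hg0 (by rw [hgh, mul_zero])
  have hw : Finsupp.weight bigradingWeight (m.degree h) = (δ.1, c) :=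
    hh (mem_support_iff.mp (m.degree_mem_support hh0))
  rw [weight_bigradingWeight, Prod.mk.injEq] at hw
  have hlm : leadingMonomial m f = leadingMonomial m g := by
    rw [leadingMonomial, leadingMonomial, hdeg]
  rw [hlm, hgh, leadingMonomial_mul m (pow_ne_zero _ sumSq_ne_zero) hh0,
    leadingMonomial_sumSq_pow m huv, leadingMonomial, monomial_eq_X_pow, hw.1]
  convert X_pow_mem_adjoin_leadingMonomial n m huv c _ _ _ e hw.2 h2 h3 using 1
  ring
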